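/- Let $r\ge 3$ and $n\ge 10^4r^3$ be integers. Every (finite, simple) graph $G$ on $n$ vertices with minimum degree $$\delta(G)\ \ge\ \Bigl(1-\frac{1}{10^4\,r^{3/2}}\Bigr)n$$ has a fractional $K_r$-decomposition; that is, writing $\mathcal{K}_r(G)$ for the set of copies of $K_r$ in $G$ (the subgraphs of $G$ isomorphic to the complete graph $K_r$ on $r$ vertices), there is a function $\omega:\mathcal{K}_r(G)\to[0,1]$ such that $$\sum_{K\in\mathcal{K}_r(G)\,:\,e\in E(K)}\omega(K)=1\qquad\text{for every edge } e\in E(G).$$ -/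

import Mathlib

/-- The copies of `F` in `G`: the (not necessarily induced) subgraphs of `G` isomorphic to `F`. -/
def SimpleGraph.CopyIn {V W : Type*} (F : SimpleGraph W) (G : SimpleGraph V) : Type _ :=
  {H : G.Subgraph // Nonempty (F ≃g H.coe)}

/-- A finite graph has finitely many subgraphs, hence finitely many copies of `F`. -/
noncomputable instance SimpleGraph.CopyIn.instFintype {V W : Type*} [Finite V]
    (F : SimpleGraph W) (G : SimpleGraph V) : Fintype (F.CopyIn G) :=
  @Fintype.ofFinite _ (inferInstanceAs (Finite {H : G.Subgraph // Nonempty (F ≃g H.coe)}))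

open Classical in
/-- `ω` is a fractional `F`-decomposition of `G`: a function from the copies of `F` in `G` to
`[0,1]` such that, for each edge `e` of `G`, the weights of the copies of `F` that contain `e`
sum to `1`. -/
def SimpleGraph.IsFractionalDecomposition {V W : Type*} [Finite V]
    (F : SimpleGraph W) (G : SimpleGraph V) (ω : F.CopyIn G → ℝ) : Prop :=
  (∀ H, ω H ∈ Set.Icc (0 : ℝ) 1) ∧
    ∀ e ∈ G.edgeSet, ∑ H : F.CopyIn G with e ∈ H.1.edgeSet, ω H = 1

/-- `G` has a fractional `F`-decomposition. -/
def SimpleGraph.HasFractionalDecomposition {V W : Type*} [Finite V]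
    (F : SimpleGraph W) (G : SimpleGraph V) : Prop :=
  ∃ ω : F.CopyIn G → ℝ, F.IsFractionalDecomposition G ω

/-! Let each vertex have at most D non-neighbours, itself included, and put p = 1/(4D). Shearer's
extremal measure from the local lemma, applied to the complement of G, is a random clique K that
contains each given clique U with probability exactly p^|U| (`sum_shearerMass_superset`).
Nonnegativity of its masses is `cliqueSum_pos_and_bounds`. Every edge therefore lies in K with the
same probability p^2.

The size of K is not fixed. An exponential-moment bound shows that, when n ≥ 32rD, cliques with
fewer than r + 2 vertices contribute at most a fraction 1/(r-1)^2 of the weight of any edge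
(`sum_large_shearerMass_bounds`). Larger cliques are averaged over their (r + 2)-subsets, which
gives a weighting of the (r + 2)-cliques that is nearly uniform on edges.

The error is corrected locally: an (r + 2)-set has as many r-subsets as pairs, so any edge weighting
of it comes from a weighting of its r-subsets, and a nearly constant one comes from a nonnegative
weighting (`gadget_nonneg`). If an edge e has total weight s(e), prescribing 1/s(e) on e in every (r
+ 2)-clique makes its total 1. -/

namespace SimpleGraph

/-! ### Shearer's measure on cliques -/

section CliqueSum

variable {V : Type*} [DecidableEq V] (G : SimpleGraph V) [DecidableRel G.Adj]

/-- The vertices of `W` adjacent to every vertex of `T`. -/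
def nbrsIn (W T : Finset V) : Finset V := {w ∈ W | ∀ u ∈ T, G.Adj u w}

/-- The cliques of `G[W]`. -/
def cliquesIn (W : Finset V) : Finset (Finset V) :=
  W.powerset.filter fun S => G.IsClique (S : Set V)

lemma mem_cliquesIn {W S : Finset V} :
    S ∈ G.cliquesIn W ↔ S ⊆ W ∧ G.IsClique (S : Set V) := by
  simp [cliquesIn]

/-- The alternating clique polynomial of `G[W]`, that is, the independence polynomial of the
complement of `G[W]` evaluated at `-t`. -/
def cliqueSum (t : ℝ) (W : Finset V) : ℝ :=
  ∑ S ∈ G.cliquesIn W, (-t) ^ S.card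

/-- The probability of the clique `T` in Shearer's extremal measure with parameter `p` on the
cliques of `G[W]`. -/
def shearerMass (p : ℝ) (W T : Finset V) : ℝ := p ^ T.card * G.cliqueSum p (G.nbrsIn W T)

lemma cliqueSum_empty (t : ℝ) : G.cliqueSum t ∅ = 1 := by
  simp [cliqueSum, cliquesIn, Finset.filter_singleton]

lemma cliqueSum_zero (W : Finset V) : G.cliqueSum 0 W = 1 := by
  unfold cliqueSum
  rw [Finset.sum_eq_single ∅]
  · simp
  · intro S _ hS
    simp [hS]
  · simp [mem_cliquesIn]

/-- Split the cliques by whether they contain v; those that do are v together with a clique among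
its neighbours in W. -/
lemma cliqueSum_insert (t : ℝ) {v : V} {W : Finset V} (hv : v ∉ W) :
    G.cliqueSum t (insert v W) = G.cliqueSum t W - t * G.cliqueSum t {w ∈ W | G.Adj v w} := by
  unfold cliqueSum cliquesIn
  rw [Finset.sum_filter, Finset.sum_powerset_insert hv, ← Finset.sum_filter, sub_eq_add_neg,
    ← neg_mul, Finset.mul_sum]
  congr 1
  rw [← Finset.sum_filter]
  have : W.powerset.filter (fun S => G.IsClique ((insert v S : Finset V) : Set V)) =
      (Finset.powerset {w ∈ W | G.Adj v w}).filter (fun S : Finset V => G.IsClique (S : Set V)) := by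
    ext S
    simp only [Finset.mem_filter, Finset.mem_powerset, Finset.coe_insert, isClique_insert]
    constructor
    · rintro ⟨h1, h2, h3⟩
      exact ⟨fun w hw => Finset.mem_filter.2 ⟨h1 hw, h3 w hw fun h => hv (h ▸ h1 hw)⟩, h2⟩
    · rintro ⟨h1, h2⟩
      exact ⟨fun w hw => (Finset.mem_filter.1 (h1 hw)).1, h2,
        fun w hw _ => (Finset.mem_filter.1 (h1 hw)).2⟩
  rw [this]
  refine Finset.sum_congr rfl fun S hS => ?_
  have hvS : v ∉ S := by
    intro h
    have := Finset.mem_powerset.1 (Finset.mem_filter.1 hS).1 h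
    exact hv (Finset.mem_filter.1 this).1
  rw [Finset.card_insert_of_notMem hvS, pow_succ]
  ring

/-- The local lemma induction. Passing from W - v to its part A adjacent to v deletes at most D
vertices, each costing at most 1/(2D), so the sum over A is at most twice that over W - v. The
deletion recursion then shows that adding v loses at most a factor 1 - 2t ≥ 1 - 1/(2D). -/
lemma cliqueSum_pos_and_bounds {t D : ℝ} (hD : 1 ≤ D) (ht : 0 ≤ t) (htD : 4 * D * t ≤ 1)
    (hG : ∀ (v : V) (W : Finset V), (({w ∈ W | ¬ G.Adj v w} : Finset V).card : ℝ) ≤ D)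
    (W : Finset V) :
    0 < G.cliqueSum t W ∧ ∀ A ⊆ W,
      (1 - (1 / (2 * D)) * ((W \ A).card : ℝ)) * G.cliqueSum t A ≤ G.cliqueSum t W ∧
        G.cliqueSum t W ≤ G.cliqueSum t A := by
  induction W using Finset.strongInduction with
  | H W ih =>
  have hD0 : 0 < D := by linarith
  set x := 1 / (2 * D) with hx
  have hxD : x * D = 1 / 2 := by rw [hx]; field_simp
  have hx0 : 0 < x := by positivity
  have hx1 : x ≤ 1 / 2 := by nlinarith
  have key : ∀ v ∈ W, 0 < G.cliqueSum t (W.erase v) ∧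
      (1 - x) * G.cliqueSum t (W.erase v) ≤ G.cliqueSum t W ∧
      G.cliqueSum t W ≤ G.cliqueSum t (W.erase v) := by
    intro v hv
    have hss := Finset.erase_ssubset hv
    obtain ⟨hU, hUA⟩ := ih _ hss
    set A : Finset V := {w ∈ W.erase v | G.Adj v w} with hA
    have hAU : A ⊆ W.erase v := Finset.filter_subset _ _
    have hA0 := (ih A (lt_of_le_of_lt hAU hss)).1
    have hrec := G.cliqueSum_insert t (Finset.notMem_erase v W)
    rw [Finset.insert_erase hv, ← hA] at hrec
    have hcard : (((W.erase v) \ A).card : ℝ) ≤ D := by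
      have : (W.erase v) \ A = {w ∈ W.erase v | ¬ G.Adj v w} := by
        rw [hA, Finset.filter_not]
      rw [this]
      exact hG _ _
    have h1 := (hUA A hAU).1
    have h2 : 1 / 2 ≤ 1 - x * (((W.erase v) \ A).card : ℝ) := by nlinarith
    have h3 : 1 / 2 * G.cliqueSum t A ≤ G.cliqueSum t (W.erase v) :=
      le_trans (mul_le_mul_of_nonneg_right h2 hA0.le) h1
    have h4 : 2 * t ≤ x := by
      rw [hx, le_div_iff₀ (by positivity)]
      linarith
    refine ⟨hU, ?_, ?_⟩
    · have : t * G.cliqueSum t A ≤ x * G.cliqueSum t (W.erase v) := by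
        calc t * G.cliqueSum t A = 2 * t * (1 / 2 * G.cliqueSum t A) := by ring
          _ ≤ 2 * t * G.cliqueSum t (W.erase v) := by gcongr
          _ ≤ _ := by gcongr
      linarith
    · have : 0 ≤ t * G.cliqueSum t A := by positivity
      linarith
  refine ⟨?_, fun A hA => ?_⟩
  · rcases W.eq_empty_or_nonempty with rfl | ⟨v, hv⟩
    · simp [cliqueSum_empty]
    · obtain ⟨h1, h2, -⟩ := key v hv
      exact lt_of_lt_of_le (mul_pos (by linarith) h1) h2
  · rcases eq_or_ne A W with rfl | hne
    · simp
    · obtain ⟨v, hvW, hvA⟩ := Finset.exists_of_ssubset (lt_of_le_of_ne hA hne)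
      obtain ⟨-, h2, h3⟩ := key v hvW
      have hAU : A ⊆ W.erase v := fun w hw =>
        Finset.mem_erase.2 ⟨fun h => hvA (h ▸ hw), hA hw⟩
      have hss := Finset.erase_ssubset hvW
      obtain ⟨h4, h5⟩ := (ih _ hss).2 A hAU
      have hA0 := (ih A (lt_of_le_of_lt hAU hss)).1
      refine ⟨?_, h3.trans h5⟩
      have hc : ((W \ A).card : ℝ) = (((W.erase v) \ A).card : ℝ) + 1 := by
        rw [Finset.erase_sdiff_comm, Finset.card_erase_of_mem (Finset.mem_sdiff.2 ⟨hvW, hvA⟩),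
          Nat.cast_sub (Finset.card_pos.2 ⟨v, Finset.mem_sdiff.2 ⟨hvW, hvA⟩⟩)]
        simp
      rw [hc]
      set m := (((W.erase v) \ A).card : ℝ)
      have hm : 0 ≤ m := Nat.cast_nonneg _
      have h6 : (1 - x) * ((1 - x * m) * G.cliqueSum t A) ≤ G.cliqueSum t W :=
        le_trans (mul_le_mul_of_nonneg_left h4 (by linarith)) h2
      -- Bernoulli: (1 - x)(1 - xm) exceeds 1 - x(m + 1) by x²m.
      have h7 : 0 ≤ x * x * m * G.cliqueSum t A := by positivity
      nlinarith

/-- By monotonicity, the term subtracted in the recursion is at least t times the sum over W. -/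
lemma cliqueSum_le_pow {t D : ℝ} (hD : 1 ≤ D) (ht : 0 ≤ t) (htD : 4 * D * t ≤ 1)
    (hG : ∀ (v : V) (W : Finset V), (({w ∈ W | ¬ G.Adj v w} : Finset V).card : ℝ) ≤ D)
    (W : Finset V) : G.cliqueSum t W ≤ (1 - t) ^ W.card := by
  induction W using Finset.induction_on with
  | empty => simp [cliqueSum_empty]
  | insert v W hv ih =>
    rw [cliqueSum_insert _ _ hv, Finset.card_insert_of_notMem hv, pow_succ]
    have h := ((G.cliqueSum_pos_and_bounds hD ht htD hG W).2
      _ (Finset.filter_subset (G.Adj v) W)).2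
    have ht1 : t ≤ 1 := by nlinarith
    have h1 := mul_le_mul_of_nonneg_left h ht
    have h2 := mul_le_mul_of_nonneg_right ih (sub_nonneg.2 ht1)
    nlinarith

omit [DecidableEq V] in
lemma disjoint_of_subset_nbrsIn {W T S : Finset V} (hS : S ⊆ G.nbrsIn W T) : Disjoint T S :=
  Finset.disjoint_right.2
    fun w hw hwT => G.loopless.irrefl w ((Finset.mem_filter.1 (hS hw)).2 w hwT)

lemma sum_cliques_superset {W T : Finset V} (hT : G.IsClique (T : Set V)) (hTW : T ⊆ W)
    (f : Finset V → ℝ) :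
    ∑ S ∈ G.cliquesIn W with T ⊆ S, f S =
      ∑ S ∈ G.cliquesIn (G.nbrsIn W T), f (T ∪ S) := by
  refine Finset.sum_nbij' (fun S => S \ T) (fun S => T ∪ S) ?_ ?_ ?_ ?_ ?_
  · intro S hS
    simp only [Finset.mem_filter, mem_cliquesIn] at hS ⊢
    obtain ⟨⟨h1, h2⟩, h3⟩ := hS
    refine ⟨fun w hw => ?_, h2.subset (by simp)⟩
    rw [Finset.mem_sdiff] at hw
    exact Finset.mem_filter.2 ⟨h1 hw.1, fun u hu =>
      h2 (h3 hu) hw.1 fun h => hw.2 (h ▸ hu)⟩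
  · intro S hS
    simp only [Finset.mem_filter, mem_cliquesIn] at hS ⊢
    obtain ⟨h1, h2⟩ := hS
    refine ⟨⟨Finset.union_subset hTW (h1.trans (Finset.filter_subset _ _)), ?_⟩,
      Finset.subset_union_left⟩
    intro a ha b hb hab
    simp only [Finset.coe_union, Set.mem_union, Finset.mem_coe] at ha hb
    rcases ha with ha | ha <;> rcases hb with hb | hb
    · exact hT ha hb hab
    · exact (Finset.mem_filter.1 (h1 hb)).2 a ha
    · exact ((Finset.mem_filter.1 (h1 ha)).2 b hb).symm
    · exact h2 ha hb hab
  · intro S hS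
    simp only [Finset.mem_filter] at hS
    exact Finset.union_sdiff_of_subset hS.2
  · intro S hS
    simp only [mem_cliquesIn] at hS
    rw [Finset.union_sdiff_left, Finset.sdiff_eq_self_of_disjoint (G.disjoint_of_subset_nbrsIn hS.1).symm]
  · intro S hS
    simp only [Finset.mem_filter] at hS
    rw [Finset.union_sdiff_of_subset hS.2]

/-- The generating function of the clique size. Expanding each mass over the cliques S ⊇ T and
exchanging sums leaves the binomial sum (y - 1)^|S|. -/
lemma sum_shearerMass_mul_pow (p y : ℝ) (W : Finset V) :
    ∑ T ∈ G.cliquesIn W, G.shearerMass p W T * y ^ T.card =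
      G.cliqueSum (p * (1 - y)) W := by
  have h1 : ∀ T ∈ G.cliquesIn W,
      G.shearerMass p W T * y ^ T.card =
        ∑ S ∈ G.cliquesIn W, if T ⊆ S then
          p ^ S.card * (y ^ T.card * (-1) ^ (S.card - T.card)) else 0 := by
    intro T hT
    rw [mem_cliquesIn] at hT
    rw [← Finset.sum_filter, G.sum_cliques_superset hT.2 hT.1, shearerMass,
      cliqueSum, Finset.mul_sum, Finset.sum_mul]
    refine Finset.sum_congr rfl fun S hS => ?_
    rw [mem_cliquesIn] at hS
    rw [Finset.card_union_of_disjoint (G.disjoint_of_subset_nbrsIn hS.1), Nat.add_sub_cancel_left,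
      neg_pow, pow_add]
    ring
  rw [Finset.sum_congr rfl h1, Finset.sum_comm, cliqueSum]
  refine Finset.sum_congr rfl fun S hS => ?_
  rw [mem_cliquesIn] at hS
  rw [← Finset.sum_filter, ← Finset.mul_sum]
  have : {T ∈ G.cliquesIn W | T ⊆ S} = S.powerset := by
    ext T
    simp only [Finset.mem_filter, mem_cliquesIn, Finset.mem_powerset]
    exact ⟨fun h => h.2, fun h => ⟨⟨h.trans hS.1, hS.2.subset (by exact_mod_cast h)⟩, h⟩⟩
  rw [this, Finset.sum_pow_mul_eq_add_pow, ← mul_pow]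
  congr 1
  ring

/-- Masses of cliques containing U are p^|U| times masses in the common neighbourhood of U. Taking y
= 1 gives the marginals p^|U|; y < 1 controls small cliques. -/
lemma sum_shearerMass_superset (p y : ℝ) {W U : Finset V} (hU : G.IsClique (U : Set V))
    (hUW : U ⊆ W) :
    ∑ T ∈ G.cliquesIn W with U ⊆ T,
        G.shearerMass p W T * y ^ (T.card - U.card) =
      p ^ U.card * G.cliqueSum (p * (1 - y)) (G.nbrsIn W U) := by
  rw [G.sum_cliques_superset hU hUW, ← sum_shearerMass_mul_pow, Finset.mul_sum]
  refine Finset.sum_congr rfl fun T hT => ?_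
  rw [mem_cliquesIn] at hT
  have : G.nbrsIn W (U ∪ T) = G.nbrsIn (G.nbrsIn W U) T := by
    ext w
    simp only [nbrsIn, Finset.mem_filter, Finset.mem_union]
    grind
  rw [shearerMass, shearerMass, Finset.card_union_of_disjoint
    (G.disjoint_of_subset_nbrsIn hT.1), Nat.add_sub_cancel_left, this, pow_add]
  ring

end CliqueSum

/-! ### Inverting the pair/r-subset incidence on r + 2 vertices -/

section Gadget

variable {V : Type*} [DecidableEq V]

/-- The weight of the `r`-subset `J \ {a, b}` in the unique weighting of the `r`-subsets of the
`(r + 2)`-set `J` that induces the edge weighting `x` on `J`. -/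
noncomputable def gadget (r : ℕ) (x : V → V → ℝ) (J : Finset V) (a b : V) : ℝ :=
  x a b - (∑ c ∈ J, x a c + ∑ c ∈ J, x b c) / (r - 1) +
    (∑ c ∈ J, ∑ d ∈ J, x c d) / (r * (r - 1))

lemma sum_eq_add_add_sum_sdiff_pair {J : Finset V} {a b : V} (ha : a ∈ J) (hb : b ∈ J)
    (hab : a ≠ b) (f : V → ℝ) : ∑ c ∈ J, f c = f a + f b + ∑ c ∈ J \ {a, b}, f c := by
  rw [← Finset.sum_sdiff (show ({a, b} : Finset V) ⊆ J by
    intro c hc; simp only [Finset.mem_insert, Finset.mem_singleton] at hc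
    rcases hc with rfl | rfl <;> assumption), Finset.sum_pair hab]
  ring

lemma card_sdiff_pair {r : ℕ} {J : Finset V} {a b : V} (ha : a ∈ J) (hb : b ∈ J)
    (hab : a ≠ b) (hJ : J.card = r + 2) : (J \ {a, b}).card = r := by
  rw [Finset.card_sdiff_of_subset (by
    intro c hc; simp only [Finset.mem_insert, Finset.mem_singleton] at hc
    rcases hc with rfl | rfl <;> assumption), Finset.card_pair hab, hJ]
  rfl

lemma sum_sum_eq_of_pair {x : V → V → ℝ} (hsymm : ∀ a b, x a b = x b a) (hdiag : ∀ a, x a a = 0)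
    {J : Finset V} {a b : V} (ha : a ∈ J) (hb : b ∈ J) (hab : a ≠ b) :
    ∑ c ∈ J, ∑ d ∈ J, x c d = 2 * x a b + 2 * ∑ c ∈ J \ {a, b}, x a c +
      2 * ∑ c ∈ J \ {a, b}, x b c + ∑ c ∈ J \ {a, b}, ∑ d ∈ J \ {a, b}, x c d := by
  have h : ∀ c, ∑ d ∈ J, x c d = x a c + x b c + ∑ d ∈ J \ {a, b}, x c d := fun c => by
    rw [sum_eq_add_add_sum_sdiff_pair ha hb hab, hsymm c a, hsymm c b]
  rw [sum_eq_add_add_sum_sdiff_pair ha hb hab, Finset.sum_congr rfl fun c _ => h c,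
    Finset.sum_add_distrib, Finset.sum_add_distrib, h a, h b, hdiag, hdiag, hsymm b a]
  ring

lemma gadget_nonneg {r : ℕ} (hr : 3 ≤ r) {x : V → V → ℝ} (hsymm : ∀ a b, x a b = x b a)
    (hdiag : ∀ a, x a a = 0) {J : Finset V} (hJ : J.card = r + 2) {α : ℝ}
    (hlow : ∀ a ∈ J, ∀ b ∈ J, a ≠ b → α ≤ x a b)
    (hupp : ∀ a ∈ J, ∀ b ∈ J, a ≠ b → x a b ≤ α * (1 + 1 / (r * (r - 2))))
    {a b : V} (ha : a ∈ J) (hb : b ∈ J) (hab : a ≠ b) : 0 ≤ gadget r x J a b := by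
  have hr' : (3 : ℝ) ≤ r := by exact_mod_cast hr
  have hL : ∀ c ∈ J \ {a, b}, c ∈ J ∧ a ≠ c ∧ b ≠ c := by
    intro c hc
    simp only [Finset.mem_sdiff, Finset.mem_insert, Finset.mem_singleton, not_or] at hc
    exact ⟨hc.1, Ne.symm hc.2.1, Ne.symm hc.2.2⟩
  have hcard := card_sdiff_pair ha hb hab hJ
  unfold gadget
  rw [sum_sum_eq_of_pair hsymm hdiag ha hb hab, sum_eq_add_add_sum_sdiff_pair ha hb hab (x a),
    sum_eq_add_add_sum_sdiff_pair ha hb hab (x b), hdiag, hdiag, hsymm b a]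
  have hP : ∑ c ∈ J \ {a, b}, x a c ≤ r * (α * (1 + 1 / (r * (r - 2)))) := by
    have := Finset.sum_le_card_nsmul (J \ {a, b}) (x a) _
      fun c hc => hupp a ha c (hL c hc).1 (hL c hc).2.1
    rwa [hcard, nsmul_eq_mul] at this
  have hQ : ∑ c ∈ J \ {a, b}, x b c ≤ r * (α * (1 + 1 / (r * (r - 2)))) := by
    have := Finset.sum_le_card_nsmul (J \ {a, b}) (x b) _
      fun c hc => hupp b hb c (hL c hc).1 (hL c hc).2.2
    rwa [hcard, nsmul_eq_mul] at this
  have hY : r * ((r - 1) * α) ≤ ∑ c ∈ J \ {a, b}, ∑ d ∈ J \ {a, b}, x c d := by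
    have h1 : ∀ c ∈ J \ {a, b}, (r - 1) * α ≤ ∑ d ∈ J \ {a, b}, x c d := by
      intro c hc
      rw [← Finset.sum_erase _ (hdiag c)]
      have := Finset.card_nsmul_le_sum ((J \ {a, b}).erase c) (x c) α fun d hd =>
        hlow c (hL c hc).1 d (hL d (Finset.mem_of_mem_erase hd)).1 (Finset.ne_of_mem_erase hd).symm
      rwa [Finset.card_erase_of_mem hc, hcard, nsmul_eq_mul, Nat.cast_sub (by omega),
        Nat.cast_one] at this
    have := Finset.card_nsmul_le_sum _ _ _ h1
    rwa [hcard, nsmul_eq_mul] at this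
  have hA := hlow a ha b hb hab
  generalize ∑ c ∈ J \ {a, b}, x a c = P at *
  generalize ∑ c ∈ J \ {a, b}, x b c = Q at *
  generalize ∑ c ∈ J \ {a, b}, ∑ d ∈ J \ {a, b}, x c d = Y at *
  generalize x a b = A at *
  have e : A - (0 + A + P + (A + 0 + Q)) / ((r : ℝ) - 1) +
      (2 * A + 2 * P + 2 * Q + Y) / (r * (r - 1)) =
      ((r - 2) * (r - 1) * A - (r - 2) * (P + Q) + Y) / (r * (r - 1)) := by
    have : (r : ℝ) - 1 ≠ 0 := by linarith
    field_simp
    ring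
  rw [e]
  have e2 : (r : ℝ) * (α * (1 + 1 / (r * (r - 2)))) * (r - 2) = r * (r - 2) * α + α := by
    have : (r : ℝ) - 2 ≠ 0 := by linarith
    field_simp
  have h1 : 0 ≤ (r - 2) * (r - 1) * (A - α) :=
    mul_nonneg (mul_nonneg (by linarith) (by linarith)) (by linarith)
  have h2 := mul_le_mul_of_nonneg_right hP (show (0 : ℝ) ≤ r - 2 by linarith)
  have h3 := mul_le_mul_of_nonneg_right hQ (show (0 : ℝ) ≤ r - 2 by linarith)
  rw [e2] at h2 h3
  exact div_nonneg (by nlinarith) (mul_nonneg (by linarith) (by linarith))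

/-- The r-subsets of J containing u and v are the complements of the pairs avoiding both. Each pair
is counted in both orders, hence the factor 2. -/
lemma sum_gadget_offDiag {r : ℕ} (hr : 3 ≤ r) {x : V → V → ℝ} (hsymm : ∀ a b, x a b = x b a)
    (hdiag : ∀ a, x a a = 0) {J : Finset V} (hJ : J.card = r + 2)
    {u v : V} (hu : u ∈ J) (hv : v ∈ J) (huv : u ≠ v) :
    ∑ q ∈ (J \ {u, v}).offDiag, gadget r x J q.1 q.2 = 2 * x u v := by
  have hr' : (3 : ℝ) ≤ r := by exact_mod_cast hr
  have hcard := card_sdiff_pair hu hv huv hJ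
  have hd : ∑ c ∈ J \ {u, v}, ∑ d ∈ J, x c d = ∑ c ∈ J \ {u, v}, x u c + ∑ c ∈ J \ {u, v}, x v c +
      ∑ c ∈ J \ {u, v}, ∑ d ∈ J \ {u, v}, x c d := by
    rw [← Finset.sum_add_distrib, ← Finset.sum_add_distrib]
    refine Finset.sum_congr rfl fun c _ => ?_
    rw [sum_eq_add_add_sum_sdiff_pair hu hv huv, hsymm c u, hsymm c v]
  have hprod : ∑ q ∈ (J \ {u, v}).offDiag, gadget r x J q.1 q.2 =
      ∑ c ∈ J \ {u, v}, ∑ d ∈ J \ {u, v}, gadget r x J c d -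
        ∑ c ∈ J \ {u, v}, gadget r x J c c := by
    rw [← Finset.sum_product', ← Finset.diag_union_offDiag,
      Finset.sum_union (Finset.disjoint_diag_offDiag _), Finset.sum_diag]
    ring
  rw [hprod]
  have hT := sum_sum_eq_of_pair hsymm hdiag hu hv huv
  unfold gadget
  simp only [Finset.sum_add_distrib, Finset.sum_sub_distrib, ← Finset.sum_div, hd, hdiag,
    Finset.sum_const, hcard, nsmul_eq_mul, ← Finset.mul_sum]
  rw [hT]
  generalize ∑ c ∈ J \ {u, v}, x u c = P
  generalize ∑ c ∈ J \ {u, v}, x v c = Q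
  generalize ∑ c ∈ J \ {u, v}, ∑ d ∈ J \ {u, v}, x c d = Y
  have : (r : ℝ) - 1 ≠ 0 := by linarith
  field_simp
  ring

end Gadget

/-! ### Correcting a nearly uniform weighting of (r + 2)-cliques -/

section Decomposition

variable {V : Type*} [DecidableEq V] [Fintype V] (G : SimpleGraph V) [DecidableRel G.Adj]

lemma sum_sum_gadget {r : ℕ} (x : V → V → ℝ) {J : Finset V} (hJ : J ∈ G.cliqueFinset (r + 2))
    {u v : V} (hu : u ∈ J) (hv : v ∈ J) :
    ∑ T ∈ (G.cliqueFinset r).filter (fun T => (u ∈ T ∧ v ∈ T) ∧ T ⊆ J),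
        ∑ q ∈ (J \ T).offDiag, gadget r x J q.1 q.2 =
      ∑ q ∈ (J \ {u, v}).offDiag, gadget r x J q.1 q.2 := by
  rw [mem_cliqueFinset_iff] at hJ
  rw [Finset.sum_sigma']
  refine Finset.sum_bij' (fun z _ => z.2) (fun q _ => ⟨J \ {q.1, q.2}, q⟩) ?_ ?_ ?_ ?_ ?_
  · rintro ⟨T, a, b⟩ h
    simp only [Finset.mem_sigma, Finset.mem_filter, Finset.mem_offDiag, Finset.mem_sdiff,
      Finset.mem_insert, Finset.mem_singleton] at h ⊢
    grind
  · rintro ⟨a, b⟩ h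
    simp only [Finset.mem_sigma, Finset.mem_filter, Finset.mem_offDiag, Finset.mem_sdiff,
      Finset.mem_insert, Finset.mem_singleton, mem_cliqueFinset_iff] at h ⊢
    refine ⟨⟨⟨hJ.1.subset (by simp), card_sdiff_pair h.1.1 h.2.1.1 h.2.2 hJ.2⟩, ?_⟩, ?_⟩
    · refine ⟨?_, Finset.sdiff_subset⟩
      grind
    · grind
  · rintro ⟨T, a, b⟩ h
    simp only [Finset.mem_sigma, Finset.mem_filter, Finset.mem_offDiag, Finset.mem_sdiff,
      mem_cliqueFinset_iff] at h
    obtain ⟨⟨⟨-, hT⟩, -, hTJ⟩, ⟨ha, haT⟩, ⟨hb, hbT⟩, hab⟩ := h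
    have : J \ {a, b} = T := by
      refine (Finset.eq_of_subset_of_card_le (fun w hw => ?_) ?_).symm
      · simp only [Finset.mem_sdiff, Finset.mem_insert, Finset.mem_singleton]
        grind
      · rw [card_sdiff_pair ha hb hab hJ.2, hT]
    simp only [this]
  · rintro ⟨a, b⟩ h
    rfl
  · rintro ⟨T, a, b⟩ h
    rfl

/-- If the `(r + 2)`-cliques of `G` can be weighted such that each edge gets almost the same
weight, then `G` has a fractional `K_r`-decomposition. -/
lemma exists_cliqueFinset_weight {r : ℕ} (hr : 3 ≤ r) {π : Finset V → ℝ}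
    (hπ : ∀ J ∈ G.cliqueFinset (r + 2), 0 ≤ π J) {c : ℝ} (hc : 0 < c)
    (hlow : ∀ u v, G.Adj u v → c * (1 - 1 / ((r : ℝ) - 1) ^ 2) ≤
      ∑ J ∈ G.cliqueFinset (r + 2) with u ∈ J ∧ v ∈ J, π J)
    (hupp : ∀ u v, G.Adj u v → ∑ J ∈ G.cliqueFinset (r + 2) with u ∈ J ∧ v ∈ J, π J ≤ c) :
    ∃ ω : Finset V → ℝ, (∀ T ∈ G.cliqueFinset r, 0 ≤ ω T) ∧
      ∀ u v, G.Adj u v → ∑ T ∈ G.cliqueFinset r with u ∈ T ∧ v ∈ T, ω T = 1 := by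
  have hr' : (3 : ℝ) ≤ r := by exact_mod_cast hr
  set s : V → V → ℝ := fun u v => ∑ J ∈ G.cliqueFinset (r + 2) with u ∈ J ∧ v ∈ J, π J with hs
  set x : V → V → ℝ := fun u v => if u = v then 0 else 1 / s u v with hx
  have hsymm : ∀ a b, x a b = x b a := fun a b => by
    simp only [hx, hs, eq_comm (a := a) (b := b), and_comm (a := a ∈ _)]
  have hdiag : ∀ a, x a a = 0 := fun a => by simp [hx]
  have h1 : (0 : ℝ) < r * (r - 2) := mul_pos (by linarith) (by linarith)
  have hcpos : 0 < c * (1 - 1 / ((r : ℝ) - 1) ^ 2) := by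
    refine mul_pos hc ?_
    rw [sub_pos, div_lt_one (by nlinarith)]
    nlinarith
  have hpos : ∀ u v, G.Adj u v → 0 < s u v := fun u v h => hcpos.trans_le (hlow u v h)
  refine ⟨fun T => ∑ J ∈ G.cliqueFinset (r + 2) with T ⊆ J,
    π J * (1 / 2 * ∑ q ∈ (J \ T).offDiag, gadget r x J q.1 q.2), ?_, ?_⟩
  · intro T hT
    refine Finset.sum_nonneg fun J hJ => ?_
    rw [Finset.mem_filter] at hJ
    refine mul_nonneg (hπ J hJ.1) (mul_nonneg (by norm_num) (Finset.sum_nonneg fun q hq => ?_))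
    rw [Finset.mem_offDiag, Finset.mem_sdiff, Finset.mem_sdiff] at hq
    have hJc := (mem_cliqueFinset_iff.1 hJ.1)
    refine gadget_nonneg hr hsymm hdiag hJc.2 (α := 1 / c) ?_ ?_ hq.1.1 hq.2.1.1 hq.2.2
    · intro a ha b hb hab
      have hadj := hJc.1 ha hb hab
      simp only [hx, if_neg hab]
      exact one_div_le_one_div_of_le (hpos a b hadj) (hupp a b hadj)
    · intro a ha b hb hab
      have hadj := hJc.1 ha hb hab
      simp only [hx, if_neg hab]
      -- The inverse of 1 - 1/(r-1)^2 is 1 + 1/(r(r-2)), the ratio the gadget tolerates.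
      refine (one_div_le_one_div_of_le hcpos (hlow a b hadj)).trans (le_of_eq ?_)
      have h2 : (r : ℝ) - 2 ≠ 0 := by linarith
      have h3 : (r : ℝ) - 1 ≠ 0 := by linarith
      have h4 : ((r : ℝ) - 1) ^ 2 - 1 ≠ 0 := by nlinarith
      field_simp
      ring
  · intro u v huv
    have hne := huv.ne
    have hswap : ∑ T ∈ G.cliqueFinset r with u ∈ T ∧ v ∈ T,
        ∑ J ∈ G.cliqueFinset (r + 2) with T ⊆ J,
          π J * (1 / 2 * ∑ q ∈ (J \ T).offDiag, gadget r x J q.1 q.2) =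
        ∑ J ∈ G.cliqueFinset (r + 2) with u ∈ J ∧ v ∈ J,
          ∑ T ∈ (G.cliqueFinset r).filter (fun T => (u ∈ T ∧ v ∈ T) ∧ T ⊆ J),
            π J * (1 / 2 * ∑ q ∈ (J \ T).offDiag, gadget r x J q.1 q.2) := by
      refine Finset.sum_comm' fun T J => ?_
      simp only [Finset.mem_filter]
      grind
    rw [hswap]
    have : ∀ J ∈ (G.cliqueFinset (r + 2)).filter (fun J => u ∈ J ∧ v ∈ J),
        ∑ T ∈ (G.cliqueFinset r).filter (fun T => (u ∈ T ∧ v ∈ T) ∧ T ⊆ J),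
            π J * (1 / 2 * ∑ q ∈ (J \ T).offDiag, gadget r x J q.1 q.2) = π J * x u v := by
      intro J hJ
      rw [Finset.mem_filter] at hJ
      rw [← Finset.mul_sum, ← Finset.mul_sum, G.sum_sum_gadget x hJ.1 hJ.2.1 hJ.2.2,
        sum_gadget_offDiag hr hsymm hdiag (mem_cliqueFinset_iff.1 hJ.1).2 hJ.2.1 hJ.2.2 hne]
      ring
    rw [Finset.sum_congr rfl this, ← Finset.sum_mul]
    change s u v * x u v = 1
    simp only [hx, if_neg hne]
    exact mul_one_div_cancel (hpos u v huv).ne'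

end Decomposition

/-! ### Discarding small cliques and averaging large ones -/

section Tail

variable {V : Type*} [DecidableEq V] (G : SimpleGraph V) [DecidableRel G.Adj]

lemma card_powersetCard_filter_pair {r : ℕ} {K : Finset V} {u v : V} (hu : u ∈ K) (hv : v ∈ K)
    (huv : u ≠ v) :
    ((K.powersetCard (r + 2)).filter (fun J => u ∈ J ∧ v ∈ J)).card = (K.card - 2).choose r := by
  have hsub : ({u, v} : Finset V) ⊆ K := by
    intro c hc
    simp only [Finset.mem_insert, Finset.mem_singleton] at hc
    rcases hc with rfl | rfl <;> assumption
  rw [← Finset.card_pair huv, ← Finset.card_sdiff_of_subset hsub, ← Finset.card_powersetCard]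
  refine Finset.card_nbij' (fun J => J \ {u, v}) (fun J => {u, v} ∪ J) ?_ ?_ ?_ ?_
  · intro J hJ
    simp only [Finset.coe_filter, Finset.mem_powersetCard, Set.mem_ofPred_eq,
      Finset.mem_coe] at hJ ⊢
    rw [Finset.card_pair huv] at hJ
    exact ⟨Finset.sdiff_subset_sdiff hJ.1.1 le_rfl, card_sdiff_pair hJ.2.1 hJ.2.2 huv hJ.1.2⟩
  · intro J hJ
    simp only [Finset.coe_filter, Finset.mem_powersetCard, Set.mem_ofPred_eq,
      Finset.mem_coe] at hJ ⊢
    refine ⟨⟨Finset.union_subset hsub (hJ.1.trans Finset.sdiff_subset), ?_⟩, by simp, by simp⟩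
    rw [Finset.card_union_of_disjoint (Finset.disjoint_sdiff.mono_right hJ.1), hJ.2, add_comm]
  · intro J hJ
    simp only [Finset.coe_filter, Finset.mem_powersetCard, Set.mem_ofPred_eq] at hJ
    grind
  · intro J hJ
    simp only [Finset.mem_powersetCard, Finset.mem_coe] at hJ
    grind

variable [Fintype V]

/-- The total over all cliques containing the edge is p^2. A discarded one has at most r - 1 further
vertices, so Markov's inequality with y = 1/2 costs the factor 2^(r-1). -/
lemma sum_large_shearerMass_bounds {p D : ℝ} (hD : 1 ≤ D) (hp : 0 ≤ p) (hpD : 4 * D * p ≤ 1)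
    (hG : ∀ (v : V) (W : Finset V), (({w ∈ W | ¬ G.Adj v w} : Finset V).card : ℝ) ≤ D)
    (r : ℕ) {u v : V} (huv : G.Adj u v) :
    p ^ 2 * (1 - 2 ^ (r - 1) * (1 - p / 2) ^ (G.nbrsIn Finset.univ {u, v}).card) ≤
        ∑ K ∈ G.cliquesIn Finset.univ with r + 2 ≤ K.card ∧ {u, v} ⊆ K,
          G.shearerMass p Finset.univ K ∧
      ∑ K ∈ G.cliquesIn Finset.univ with r + 2 ≤ K.card ∧ {u, v} ⊆ K,
          G.shearerMass p Finset.univ K ≤ p ^ 2 := by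
  have hU : G.IsClique (({u, v} : Finset V) : Set V) := by
    simpa [isClique_insert] using fun _ => huv
  have hmass : ∀ K, 0 ≤ G.shearerMass p Finset.univ K := fun K =>
    mul_nonneg (pow_nonneg hp _) (G.cliqueSum_pos_and_bounds hD hp hpD hG _).1.le
  have htotal := G.sum_shearerMass_superset p 1 hU (Finset.subset_univ _)
  have hhalf := G.sum_shearerMass_superset p (1 / 2) hU (Finset.subset_univ _)
  simp only [one_pow, mul_one, sub_self, mul_zero, cliqueSum_zero, Finset.card_pair huv.ne]
    at htotal hhalf
  have hle := G.cliqueSum_le_pow hD (t := p * (1 - 1 / 2)) (by linarith) (by nlinarith) hG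
    (G.nbrsIn Finset.univ {u, v})
  rw [show p * (1 - 1 / 2) = p / 2 by ring] at hle hhalf
  rw [← Finset.sum_filter_add_sum_filter_not _ (fun K => r + 2 ≤ K.card),
    Finset.filter_filter, Finset.filter_filter] at htotal
  have hcomm : ∀ (K : Finset V) (P : Prop), {u, v} ⊆ K ∧ P ↔ P ∧ {u, v} ⊆ K :=
    fun _ _ => and_comm
  simp only [hcomm] at htotal
  have hsmall : ∑ K ∈ G.cliquesIn Finset.univ with ¬ r + 2 ≤ K.card ∧ {u, v} ⊆ K,
      G.shearerMass p Finset.univ K ≤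
      2 ^ (r - 1) * (p ^ 2 * (1 - p / 2) ^ (G.nbrsIn Finset.univ {u, v}).card) := by
    calc _ ≤ ∑ K ∈ G.cliquesIn Finset.univ with ¬ r + 2 ≤ K.card ∧ {u, v} ⊆ K,
          2 ^ (r - 1) * (G.shearerMass p Finset.univ K * (1 / 2) ^ (K.card - 2)) := by
          refine Finset.sum_le_sum fun K hK => ?_
          rw [Finset.mem_filter] at hK
          have h1 : (1 / 2 : ℝ) ^ (r - 1) ≤ (1 / 2) ^ (K.card - 2) :=
            pow_le_pow_of_le_one (by norm_num) (by norm_num) (by omega)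
          have h2 : (2 : ℝ) ^ (r - 1) * (1 / 2) ^ (r - 1) = 1 := by
            rw [← mul_pow]; norm_num
          have h3 : 1 ≤ (2 : ℝ) ^ (r - 1) * (1 / 2) ^ (K.card - 2) :=
            h2.symm.le.trans (mul_le_mul_of_nonneg_left h1 (by positivity))
          nlinarith [hmass K]
      _ ≤ ∑ K ∈ G.cliquesIn Finset.univ with {u, v} ⊆ K,
          2 ^ (r - 1) * (G.shearerMass p Finset.univ K * (1 / 2) ^ (K.card - 2)) := by
          refine Finset.sum_le_sum_of_subset_of_nonneg (fun K hK => ?_) fun K _ _ => ?_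
          · rw [Finset.mem_filter] at hK ⊢
            exact ⟨hK.1, hK.2.2⟩
          · have := hmass K
            positivity
      _ ≤ _ := by
          rw [← Finset.mul_sum, hhalf]
          gcongr
  have hsmall0 : 0 ≤ ∑ K ∈ G.cliquesIn Finset.univ with ¬ r + 2 ≤ K.card ∧ {u, v} ⊆ K,
      G.shearerMass p Finset.univ K := Finset.sum_nonneg fun K _ => hmass K
  constructor <;> linarith

/-- The divisor counts the (r + 2)-subsets of K through a fixed pair, so averaging preserves the
weight K gives to each of its edges. -/
lemma sum_cliqueFinset_average {r : ℕ} (μ : Finset V → ℝ) {u v : V} (huv : u ≠ v) :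
    ∑ J ∈ G.cliqueFinset (r + 2) with u ∈ J ∧ v ∈ J,
        ∑ K ∈ G.cliquesIn Finset.univ with r + 2 ≤ K.card ∧ J ⊆ K,
          μ K / ((K.card - 2).choose r : ℝ) =
      ∑ K ∈ G.cliquesIn Finset.univ with r + 2 ≤ K.card ∧ {u, v} ⊆ K, μ K := by
  have hswap : ∑ J ∈ G.cliqueFinset (r + 2) with u ∈ J ∧ v ∈ J,
        ∑ K ∈ G.cliquesIn Finset.univ with r + 2 ≤ K.card ∧ J ⊆ K,
          μ K / ((K.card - 2).choose r : ℝ) =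
      ∑ K ∈ G.cliquesIn Finset.univ with r + 2 ≤ K.card ∧ {u, v} ⊆ K,
        ∑ J ∈ (K.powersetCard (r + 2)).filter (fun J => u ∈ J ∧ v ∈ J),
          μ K / ((K.card - 2).choose r : ℝ) := by
    refine Finset.sum_comm' fun J K => ?_
    simp only [Finset.mem_filter, mem_cliqueFinset_iff, mem_cliquesIn, Finset.mem_powersetCard,
      Finset.insert_subset_iff, Finset.singleton_subset_iff]
    constructor
    · rintro ⟨⟨h1, h2⟩, h3, h4, h5⟩
      exact ⟨⟨⟨h5, h1.2⟩, h2⟩, h3, h4, h5 h2.1, h5 h2.2⟩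
    · rintro ⟨⟨⟨h1, h2⟩, h3⟩, h4, h5, -⟩
      exact ⟨⟨⟨h4.2.subset (by exact_mod_cast h1), h2⟩, h3⟩, h4, h5, h1⟩
  rw [hswap]
  refine Finset.sum_congr rfl fun K hK => ?_
  simp only [Finset.mem_filter, Finset.insert_subset_iff, Finset.singleton_subset_iff] at hK
  rw [Finset.sum_const, card_powersetCard_filter_pair hK.2.2.1 hK.2.2.2 huv, nsmul_eq_mul]
  have : ((K.card - 2).choose r : ℝ) ≠ 0 := by
    have := Nat.choose_pos (show r ≤ K.card - 2 by omega)
    positivity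
  field_simp

lemma card_le_card_nbrsIn_pair {D : ℝ}
    (hG : ∀ (v : V) (W : Finset V), (({w ∈ W | ¬ G.Adj v w} : Finset V).card : ℝ) ≤ D)
    (u v : V) :
    (Fintype.card V : ℝ) - 2 * D ≤ (G.nbrsIn Finset.univ {u, v}).card := by
  have h : (Finset.univ : Finset V) ⊆ G.nbrsIn Finset.univ {u, v} ∪
      (({w ∈ Finset.univ | ¬ G.Adj u w} : Finset V) ∪
        ({w ∈ Finset.univ | ¬ G.Adj v w} : Finset V)) := by
    intro w _
    simp only [nbrsIn, Finset.mem_union, Finset.mem_filter, Finset.mem_univ, true_and,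
      Finset.mem_insert, Finset.mem_singleton, forall_eq_or_imp, forall_eq]
    tauto
  have h1 := (Finset.card_le_card h).trans ((Finset.card_union_le _ _).trans
    (Nat.add_le_add_left (Finset.card_union_le _ _) _))
  rw [Finset.card_univ] at h1
  have h2 : (Fintype.card V : ℝ) ≤ _ := Nat.cast_le.2 h1
  push_cast at h2
  linarith [hG u Finset.univ, hG v Finset.univ]

lemma two_pow_mul_one_sub_pow_le {r N : ℕ} (hr : 2 ≤ r) {q : ℝ} (hq : q ≤ 1)
    (h : 3 * r ≤ q * N) : 2 ^ (r - 1) * (1 - q) ^ N ≤ 1 / ((r : ℝ) - 1) ^ 2 := by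
  have hr' : (2 : ℝ) ≤ r := by exact_mod_cast hr
  have h1 : (1 - q) ^ N ≤ (1 / 8 : ℝ) ^ r := by
    calc (1 - q) ^ N ≤ (Real.exp (-q)) ^ N :=
          pow_le_pow_left₀ (by linarith) (Real.one_sub_le_exp_neg q) N
      _ = Real.exp (-(q * N)) := by rw [← Real.exp_nat_mul]; ring_nf
      _ ≤ Real.exp (-(3 * r)) := by gcongr
      _ = (Real.exp (-1)) ^ (3 * r) := by rw [← Real.exp_nat_mul]; push_cast; ring_nf
      _ ≤ (1 / 2) ^ (3 * r) := by
          gcongr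
          rw [Real.exp_neg, ← one_div]
          exact one_div_le_one_div_of_le (by norm_num) (by linarith [Real.add_one_le_exp (1 : ℝ)])
      _ = (1 / 8) ^ r := by rw [pow_mul]; norm_num
  have h2 : (2 : ℝ) ^ (r - 1) ≤ 2 ^ r := pow_le_pow_right₀ (by norm_num) (by omega)
  have h3 : (r : ℝ) ≤ 2 ^ r := by exact_mod_cast Nat.lt_two_pow_self.le
  calc (2 : ℝ) ^ (r - 1) * (1 - q) ^ N ≤ 2 ^ r * (1 / 8) ^ r := by gcongr
    _ = 1 / (2 ^ r) ^ 2 := by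
        rw [← mul_pow, ← pow_mul, mul_comm r 2, pow_mul, ← one_div_pow]
        norm_num
    _ ≤ 1 / ((r : ℝ) - 1) ^ 2 := by
        apply one_div_le_one_div_of_le
        · nlinarith
        · gcongr <;> linarith

/-- If every vertex of `G`, a graph on `n ≥ 32 r D` vertices, has at most `D` non-neighbours, then
the `r`-cliques of `G` can be weighted such that each edge has weight `1`. -/
lemma exists_cliqueFinset_weight_of_card_not_adj_le {r : ℕ} (hr : 3 ≤ r) {D : ℝ} (hD : 1 ≤ D)
    (hG : ∀ (v : V) (W : Finset V), (({w ∈ W | ¬ G.Adj v w} : Finset V).card : ℝ) ≤ D)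
    (hn : 32 * r * D ≤ Fintype.card V) :
    ∃ ω : Finset V → ℝ, (∀ T ∈ G.cliqueFinset r, 0 ≤ ω T) ∧
      ∀ u v, G.Adj u v → ∑ T ∈ G.cliqueFinset r with u ∈ T ∧ v ∈ T, ω T = 1 := by
  have hr' : (3 : ℝ) ≤ r := by exact_mod_cast hr
  have hD0 : 0 < D := by linarith
  set p : ℝ := 1 / (4 * D) with hp
  have hp0 : 0 < p := by positivity
  have hpD : 4 * D * p = 1 := by rw [hp]; field_simp
  have hmass : ∀ K, 0 ≤ G.shearerMass p Finset.univ K := fun K =>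
    mul_nonneg (pow_nonneg hp0.le _) (G.cliqueSum_pos_and_bounds hD hp0.le hpD.le hG _).1.le
  refine G.exists_cliqueFinset_weight hr (c := p ^ 2)
    (π := fun J => ∑ K ∈ G.cliquesIn Finset.univ with r + 2 ≤ K.card ∧ J ⊆ K,
      G.shearerMass p Finset.univ K / ((K.card - 2).choose r : ℝ))
    (fun J _ => Finset.sum_nonneg fun K _ => div_nonneg (hmass K) (Nat.cast_nonneg _))
    (by positivity) ?_ ?_
  · intro u v huv
    rw [G.sum_cliqueFinset_average _ huv.ne]
    refine le_trans ?_ (G.sum_large_shearerMass_bounds hD hp0.le hpD.le hG r huv).1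
    have hN := G.card_le_card_nbrsIn_pair hG u v
    have hq : 3 * r ≤ p / 2 * ((G.nbrsIn Finset.univ {u, v}).card : ℝ) := by
      -- Since pD = 1/4, the middle term equals 4r - 1/4.
      calc (3 : ℝ) * r ≤ p / 2 * (32 * r * D - 2 * D) := by nlinarith
        _ ≤ p / 2 * ((G.nbrsIn Finset.univ {u, v}).card : ℝ) := by
          gcongr
          linarith
    have := two_pow_mul_one_sub_pow_le (by omega) (by nlinarith) hq
    gcongr
  · intro u v huv
    rw [G.sum_cliqueFinset_average _ huv.ne]
    exact (G.sum_large_shearerMass_bounds hD hp0.le hpD.le hG r huv).2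

end Tail

/-! ### From r-cliques to copies of the complete graph -/

section Copies

variable {V : Type*} {G : SimpleGraph V} {r : ℕ}

lemma CopyIn.adj_iff (H : (completeGraph (Fin r)).CopyIn G) {u v : V} :
    H.1.Adj u v ↔ u ≠ v ∧ u ∈ H.1.verts ∧ v ∈ H.1.verts := by
  obtain ⟨e⟩ := H.2
  refine ⟨fun h => ⟨h.ne, h.fst_mem, h.snd_mem⟩, fun ⟨hne, hu, hv⟩ => ?_⟩
  have : H.1.coe.Adj (e (e.symm ⟨u, hu⟩)) (e (e.symm ⟨v, hv⟩)) := by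
    rw [e.map_adj_iff]
    simpa [completeGraph] using hne
  simpa using this

lemma CopyIn.verts_injective :
    Function.Injective fun H : (completeGraph (Fin r)).CopyIn G => H.1.verts := by
  intro H H' h
  refine Subtype.ext (Subgraph.ext h ?_)
  ext u v
  simp only [CopyIn.adj_iff]
  change H.1.verts = H'.1.verts at h
  rw [h]

lemma CopyIn.isNClique [Fintype V] [DecidableEq V] (H : (completeGraph (Fin r)).CopyIn G)
    [Fintype H.1.verts] : G.IsNClique r H.1.verts.toFinset := by
  obtain ⟨e⟩ := H.2
  refine ⟨fun u hu v hv huv => ?_, ?_⟩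
  · rw [Set.coe_toFinset] at hu hv
    exact (H.adj_iff.2 ⟨huv, hu, hv⟩).adj_sub
  · rw [Set.toFinset_card, ← Fintype.card_congr e.toEquiv, Fintype.card_fin]

lemma IsNClique.exists_copyIn {T : Finset V} (hT : G.IsNClique r T) :
    ∃ H : (completeGraph (Fin r)).CopyIn G, H.1.verts = T := by
  refine ⟨⟨(⊤ : G.Subgraph).induce T, ?_⟩, rfl⟩
  have e : Fin r ≃ (T : Set V) := (T.equivFinOfCardEq hT.2).symm
  refine ⟨⟨e, ?_⟩⟩
  intro a b
  have hne : (e a : V) ≠ e b ↔ a ≠ b := by simp [Subtype.ext_iff.symm]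
  simp only [Subgraph.coe_adj, Subgraph.induce_adj, Subgraph.top_adj, completeGraph, top_adj]
  exact ⟨fun h => hne.1 h.2.2.ne, fun h => ⟨(e a).2, (e b).2, hT.1 (e a).2 (e b).2 (hne.2 h)⟩⟩

lemma hasFractionalDecomposition_completeGraph [Fintype V] [DecidableEq V] [DecidableRel G.Adj]
    (hr : 2 ≤ r) {ω : Finset V → ℝ} (hω : ∀ T ∈ G.cliqueFinset r, 0 ≤ ω T)
    (hsum : ∀ u v, G.Adj u v → ∑ T ∈ G.cliqueFinset r with u ∈ T ∧ v ∈ T, ω T = 1) :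
    (completeGraph (Fin r)).HasFractionalDecomposition G := by
  classical
  -- As r ≥ 2, T contains an edge, and its weight is one of the nonnegative terms summing to 1
  -- there.
  have hle : ∀ T ∈ G.cliqueFinset r, ω T ≤ 1 := by
    intro T hT
    have hTc := mem_cliqueFinset_iff.1 hT
    obtain ⟨u, hu, v, hv, huv⟩ := Finset.one_lt_card.1 (hr.trans_eq hTc.2.symm)
    rw [← hsum u v (hTc.1 hu hv huv)]
    exact Finset.single_le_sum (f := ω) (fun S hS => hω S (Finset.mem_filter.1 hS).1)
      (Finset.mem_filter.2 ⟨hT, hu, hv⟩)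
  have hmem : ∀ H : (completeGraph (Fin r)).CopyIn G, H.1.verts.toFinset ∈ G.cliqueFinset r :=
    fun H => mem_cliqueFinset_iff.2 H.isNClique
  refine ⟨fun H => ω H.1.verts.toFinset, fun H => ⟨hω _ (hmem H), hle _ (hmem H)⟩, ?_⟩
  intro e
  induction e with
  | _ u v =>
  intro huv
  rw [mem_edgeSet] at huv
  rw [← hsum u v huv]
  refine Finset.sum_bij (fun H _ => H.1.verts.toFinset) ?_ ?_ ?_ ?_
  · intro H hH
    rw [Finset.mem_filter, Subgraph.mem_edgeSet, H.adj_iff] at hH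
    rw [Finset.mem_filter, Set.mem_toFinset, Set.mem_toFinset]
    exact ⟨hmem H, hH.2.2⟩
  · intro H _ H' _ h
    exact CopyIn.verts_injective (Set.toFinset_inj.1 h)
  · intro T hT
    rw [Finset.mem_filter, mem_cliqueFinset_iff] at hT
    obtain ⟨H, hH⟩ := hT.1.exists_copyIn
    refine ⟨H, ?_, by simp [hH]⟩
    rw [Finset.mem_filter, Subgraph.mem_edgeSet, H.adj_iff, hH]
    exact ⟨Finset.mem_univ _, huv.ne, by simpa using hT.2⟩
  · intro H _
    rfl

end Copies

end SimpleGraph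

theorem theorem1p3 (r n : ℕ) (hr : 3 ≤ r) (hn : 10 ^ 4 * r ^ 3 ≤ n)
    {V : Type*} [Fintype V] (hV : Fintype.card V = n)
    (G : SimpleGraph V) [DecidableRel G.Adj]
    (hG : (1 - 1 / (10 ^ 4 * (r : ℝ) ^ (3 / 2 : ℝ))) * (n : ℝ) ≤ (G.minDegree : ℝ)) :
    (SimpleGraph.completeGraph (Fin r)).HasFractionalDecomposition G := by
  classical
  have hr' : (3 : ℝ) ≤ r := by exact_mod_cast hr
  have hn' : (10 : ℝ) ^ 4 * r ^ 3 ≤ n := by exact_mod_cast hn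
  have hlow : (r : ℝ) ≤ (r : ℝ) ^ (3 / 2 : ℝ) :=
    Real.self_le_rpow_of_one_le (by linarith) (by norm_num)
  have hupp : (r : ℝ) ^ (3 / 2 : ℝ) ≤ (r : ℝ) ^ 3 := by
    rw [← Real.rpow_natCast]
    exact Real.rpow_le_rpow_of_exponent_le (by linarith) (by norm_num)
  set R := (r : ℝ) ^ (3 / 2 : ℝ)
  have hR : 0 < R := by linarith
  set D : ℝ := n / (10 ^ 4 * R) with hD
  have hDn : 10 ^ 4 * R * D = n := by rw [hD]; field_simp
  have hD1 : 1 ≤ D := by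
    rw [hD, one_le_div (by positivity)]
    linarith
  have hdeg : (n : ℝ) - D ≤ G.minDegree := by
    refine le_trans (le_of_eq ?_) hG
    rw [hD]
    ring
  obtain ⟨ω, hω, hsum⟩ := G.exists_cliqueFinset_weight_of_card_not_adj_le hr hD1
    (fun v W => by
      have h1 : ({w ∈ W | ¬ G.Adj v w} : Finset V).card ≤ (G.neighborFinset v)ᶜ.card :=
        Finset.card_le_card fun w hw => by
          simpa using (Finset.mem_filter.1 hw).2
      have h2 := Finset.card_add_card_compl (G.neighborFinset v)
      rw [G.card_neighborFinset_eq_degree, hV] at h2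
      have h3 := G.minDegree_le_degree v
      have h4 : (G.minDegree : ℝ) + ({w ∈ W | ¬ G.Adj v w} : Finset V).card ≤ n := by
        exact_mod_cast (by omega)
      linarith)
    -- Only R ≥ r is needed here: 10^4 R ≥ 32r with much room to spare.
    (by rw [hV, ← hDn]; nlinarith)
  exact SimpleGraph.hasFractionalDecomposition_completeGraph (by omega) hω hsum
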